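/- Let $G$ be a directed acyclic graph with finite vertex set $V$. The (centred) Gaussian graphical model of $G$ is the set of laws on $\mathbb{R}^V$ of the random vectors $X=(X_j)_{j\in V}$ satisfying the recursive regressions $$X_j=\sum_{i\to j\in E(G)}\lambda_{ij}X_i+\varepsilon_j\qquad(j\in V),$$ where the $\lambda_{ij}\in\mathbb{R}$ are arbitrary and the $\varepsilon_j\sim\mathcal N(0,\phi_j)$ are independent with arbitrary $\phi_j>0$. For $A,B,C\subseteq V$ pairwise disjoint, $X_A\perp\!\!\!\perp X_B\mid X_C$ is said to hold for $G$ if $X_A$ and $X_B$ are conditionally independent given $X_C$ for every distribution in this model. A trek from $i$ to $j$ is a pair $(P_1,P_2)$ of directed paths of $G$ (possibly consisting of a single vertex) with a common source, such that $P_1$ has sink $i$ and $P_2$ has sink $j$. For $S,T,C_A,C_B\subseteq V$ (not necessarily disjoint), $(C_A,C_B)$ $t$-separates $S$ from $T$ if for every trek $(P_1,P_2)$ from a vertex of $S$ to a vertex of $T$, either $P_1$ contains a vertex of $C_A$ or $P_2$ contains a vertex of $C_B$. **Theorem.** Let $A,B,C\subseteq V$ be pairwise disjoint. Then $X_A\perp\!\!\!\perp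 X_B\mid X_C$ holds for $G$ if and only if there are disjoint (possibly empty) sets $C_A,C_B$ with $C_A\cup C_B=C$ such that $(C_A,C_B)$ $t$-separates $A\cup C$ from $B\cup C$ in $G$. -/

import Mathlib

open MeasureTheory ProbabilityTheory
open scoped NNReal

namespace GaussianDAG

variable {V : Type*}

/-- A digraph is acyclic if no vertex can be reached from itself by a directed walk with at least
one edge. In particular there are no loops. -/
def IsAcyclic (G : Digraph V) : Prop :=
  ∀ v : V, ¬ Relation.TransGen G.Adj v v

/-- `p` is the vertex sequence of a directed path of `G` with source `s` and sink `t`.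
The one-vertex sequence `[s]` is a directed path from `s` to `s`.
(In an acyclic digraph the vertices of a directed walk are automatically distinct.) -/
def IsDirectedPath (G : Digraph V) (s t : V) (p : List V) : Prop :=
  p.head? = some s ∧ p.getLast? = some t ∧ p.IsChain G.Adj

/-- `(p₁, p₂)` is a trek from `i` to `j`: two directed paths with a common source `k` (the top),
the first one with sink `i` and the second one with sink `j`. -/
def IsTrek (G : Digraph V) (i j : V) (p₁ p₂ : List V) : Prop :=
  ∃ k : V, IsDirectedPath G k i p₁ ∧ IsDirectedPath G k j p₂

/-- `(CA, CB)` trek-separates `A` from `B`: for every trek `(p₁, p₂)` from a vertex of `A` to a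
vertex of `B`, either `p₁` contains a vertex of `CA` or `p₂` contains a vertex of `CB`. -/
def TSeparates (G : Digraph V) (CA CB A B : Finset V) : Prop :=
  ∀ i ∈ A, ∀ j ∈ B, ∀ p₁ p₂ : List V, IsTrek G i j p₁ p₂ →
    (∃ c ∈ CA, c ∈ p₁) ∨ (∃ c ∈ CB, c ∈ p₂)

/-- The distribution `μ` on `ℝ^V` belongs to the (centred) Gaussian graphical model of `G`.

The random vector `X` with law `μ` is the family of coordinates `x j` on `ℝ^V`. The condition says
that there are regression coefficients `L i j`, supported on the edges `i → j` of `G`, and variances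
`φ j > 0`, such that the error terms `ε j = X j - ∑ i ∈ pa(j), L i j * X i` of the recursive
regressions `X j = ∑ i ∈ pa(j), L i j * X i + ε j` are independent with `ε j ∼ N(0, φ j)`. -/
def InModel [Fintype V] (G : Digraph V) (μ : Measure (V → ℝ)) : Prop :=
  ∃ (L : Matrix V V ℝ) (φ : V → ℝ≥0),
    (∀ i j, ¬ G.Adj i j → L i j = 0) ∧
    (∀ j, 0 < φ j) ∧
    (∀ j, HasLaw (fun x : V → ℝ => x j - ∑ i, L i j * x i) (gaussianReal 0 (φ j)) μ) ∧
    iIndepFun (fun (j : V) (x : V → ℝ) => x j - ∑ i, L i j * x i) μ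

/-- The conditional independence statement `X_A ⊥ X_B | X_C` for a random vector `X` with law `μ`
on `ℝ^V`: the coordinate vectors `X_A` and `X_B` are conditionally independent given the
σ-algebra generated by `X_C`. -/
def CondIndepStatement [Fintype V] (A B C : Finset V) (μ : Measure (V → ℝ))
    [IsFiniteMeasure μ] : Prop :=
  CondIndepFun
    (MeasurableSpace.comap (C.restrict : (V → ℝ) → (C → ℝ)) inferInstance)
    (Finset.measurable_restrict C).comap_le
    (A.restrict : (V → ℝ) → (A → ℝ)) (B.restrict : (V → ℝ) → (B → ℝ)) μ

/-- The conditional independence statement `X_A ⊥ X_B | X_C` holds for the graph `G`: it holds for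
every distribution in the Gaussian graphical model of `G`. -/
def CondIndepHolds [Fintype V] (G : Digraph V) (A B C : Finset V) : Prop :=
  ∀ (μ : Measure (V → ℝ)) [IsProbabilityMeasure μ],
    InModel G μ → CondIndepStatement A B C μ

end GaussianDAG

/-!
The proof passes through a reachability relation, `BayesBall`, and treats the two implications by
unrelated means.

*Trek separation implies conditional independence.* This half uses only that the errors are
independent. Write each variable as `X v = f (X_CA) + Y v`, where `Y v` depends only on the errors
at vertices from which some directed path reaches `v` without meeting `CA` (`exists_noise_part`),
and likewise `X v = g (X_CB) + Z v`. Trek separation says exactly that the errors occurring in the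
`Y v`, `v ∈ A ∪ C`, and those occurring in the `Z v`, `v ∈ B ∪ C`, have disjoint index sets, so
that the two families are independent. By acyclicity `X_C` and the pair `(Y_CB, Z_CA)` determine
each other, and independence of two σ-algebras survives conditioning on the join of a
sub-σ-algebra of each (`condIndep_sup_of_indep`). As `X_A` is a function of `Y_A` and `X_C`, and
`X_B` of `Z_B` and `X_C`, the claim follows (`TSeparates.condIndepStatement`).

*Conditional independence implies trek separation.* Let a ball start at `a ∈ A` and move along
edges in either direction, passing through `v ∉ C` unless both edges point into `v`, and bouncing
at `v ∈ C` if both edges point into `v`. If no vertex of `B` is reached downwards, then the set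
`CB` of the vertices of `C` reached downwards, together with `CA = C \ CB`, trek-separates
(`exists_tSeparates_of_not_bayesBall`). If some `b ∈ B` is reached, a distribution of the model
violates the independence statement:

* By Hall's theorem there is a set `S` of `|C| + 1` vertices that is linked by vertex-disjoint paths
  both to `{a} ∪ C` and to `{b} ∪ C`; a violation of Hall's condition would confine the ball
  (`BayesBall.exists_linked`).
* With `0/1` edge weights taken from one linkage, the block of `(1 - L)⁻¹` with rows `S` and columns
  the end points is nonsingular (`Linked.exists_weights`). Determinants being polynomials, one
  `L` on the line through the two weightings serves both linkages. With error variances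
  close to the indicator of `S`, the covariance block with rows `{a} ∪ C` and columns `{b} ∪ C`
  is close to a product of two nonsingular matrices (`BayesBall.exists_nonsingular`).
* Conditional independence makes this block singular: the error `R` of the regression of `X_a` on
  `X_C` is Gaussian and uncorrelated with `X_C`, hence independent of it; as it is also
  conditionally independent of `X_b`, it is independent of `X_b`. The coefficients of `R` form
  a nonzero vector in the left kernel (`CondIndepStatement.exists_vecMul_covMatrix_eq_zero`).
-/

namespace GaussianDAG

variable {V : Type*}

/-! ### Bayes ball reachability and trek separation -/

/-- `BayesBall G C a d v`: a ball released at `a` can reach `v` given `C`. If `d = true` it arrives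
travelling up, against the arrow of an edge `v → w` (or it starts at `v`); if `d = false` it
arrives travelling down, along an edge `u → v`, or has just turned round at the top of a trek.
Vertices of `C` absorb a ball travelling up and reflect a ball travelling down. -/
inductive BayesBall (G : Digraph V) (C : Finset V) (a : V) : Bool → V → Prop
  | start : BayesBall G C a true a
  | up {u v : V} : BayesBall G C a true v → v ∉ C → G.Adj u v → BayesBall G C a true u
  | turn {v : V} : BayesBall G C a true v → v ∉ C → BayesBall G C a false v
  | down {v w : V} : BayesBall G C a false v → v ∉ C → G.Adj v w → BayesBall G C a false w
  | bounce {u v : V} : BayesBall G C a false v → v ∈ C → G.Adj u v → BayesBall G C a true u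

/-- The vertices of `C` reached downwards and the remaining ones form a trek-separating pair as soon
as no vertex of `B` is reached downwards. -/
theorem exists_tSeparates_of_not_bayesBall [DecidableEq V] {G : Digraph V} {A B C : Finset V}
    (h : ∀ a ∈ A, ∀ b ∈ B, ¬ BayesBall G C a false b) :
    ∃ CA CB : Finset V, CA ∪ CB = C ∧ Disjoint CA CB ∧ TSeparates G CA CB (A ∪ C) (B ∪ C) := by
  classical
  set CB := C.filter fun c => ∃ a ∈ A, BayesBall G C a false c with hCB
  refine ⟨C \ CB, CB, Finset.sdiff_union_of_subset (Finset.filter_subset _ _),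
    Finset.sdiff_disjoint, ?_⟩
  rintro i hi j hj p₁ p₂ ⟨k, ⟨hk₁, hi₁, hp₁⟩, ⟨hk₂, hj₂, hp₂⟩⟩
  by_contra! hcon
  obtain ⟨h₁, h₂⟩ := hcon
  -- Climbing the first path from its sink, the ball reaches every vertex that is not in `CB`.
  have climb : ∀ (p : List V) (k : V), p.head? = some k → p.getLast? = some i →
      p.IsChain G.Adj → (∀ c ∈ C \ CB, c ∉ p) → k ∈ CB ∨ ∃ a ∈ A, BayesBall G C a true k := by
    intro p
    induction p with
    | nil => intro k hk; simp at hk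
    | cons v p ih =>
      intro k hk hl hp hav
      obtain rfl : v = k := by simpa using hk
      have hvC : v ∈ C → v ∈ CB := fun hv => by
        by_contra hv'
        exact hav v (Finset.mem_sdiff.2 ⟨hv, hv'⟩) (by simp)
      cases p with
      | nil =>
        obtain rfl : v = i := by simpa using hl
        rcases Finset.mem_union.1 hi with hA | hC
        · exact Or.inr ⟨v, hA, .start⟩
        · exact Or.inl (hvC hC)
      | cons w p =>
        rw [List.isChain_cons_cons] at hp
        rcases ih w rfl (by simpa using hl) hp.2
          (fun c hc hc' => hav c hc (List.mem_cons_of_mem _ hc')) with hw | ⟨a, ha, hw⟩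
        · obtain ⟨hwC, a, ha, hw⟩ := Finset.mem_filter.1 hw
          exact Or.inr ⟨a, ha, hw.bounce hwC hp.1⟩
        · by_cases hwC : w ∈ C
          · have : w ∈ CB := by
              by_contra hw'
              exact hav w (Finset.mem_sdiff.2 ⟨hwC, hw'⟩) (by simp)
            obtain ⟨-, a, ha, hw⟩ := Finset.mem_filter.1 this
            exact Or.inr ⟨a, ha, hw.bounce hwC hp.1⟩
          · exact Or.inr ⟨a, ha, hw.up hwC hp.1⟩
  -- Descending the second path, it stays outside `CB` and therefore outside `C`.
  have descend : ∀ (p : List V) (k a : V), a ∈ A → p.head? = some k → p.getLast? = some j →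
      p.IsChain G.Adj → (∀ c ∈ CB, c ∉ p) → ¬ BayesBall G C a false k := by
    intro p
    induction p with
    | nil => intro k a ha hk; simp at hk
    | cons v p ih =>
      intro k a ha hk hl hp hav hball
      obtain rfl : v = k := by simpa using hk
      have hvC : v ∉ C := fun hv =>
        hav v (Finset.mem_filter.2 ⟨hv, a, ha, hball⟩) (by simp)
      cases p with
      | nil =>
        obtain rfl : v = j := by simpa using hl
        exact h a ha v ((Finset.mem_union.1 hj).resolve_right hvC) hball
      | cons w p =>
        rw [List.isChain_cons_cons] at hp
        exact ih w a ha rfl (by simpa using hl) hp.2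
          (fun c hc hc' => hav c hc (List.mem_cons_of_mem _ hc')) (hball.down hvC hp.1)
  have hkp₂ : k ∈ p₂ := List.mem_of_mem_head? hk₂
  have hkp₁ : k ∈ p₁ := List.mem_of_mem_head? hk₁
  have hkCB : k ∉ CB := fun hk => h₂ k hk hkp₂
  have hkC : k ∉ C := fun hk => h₁ k (Finset.mem_sdiff.2 ⟨hk, hkCB⟩) hkp₁
  obtain ⟨a, ha, hball⟩ := (climb p₁ k hk₁ hi₁ hp₁ h₁).resolve_left hkCB
  exact descend p₂ k a ha hk₂ hj₂ hp₂ h₂ (hball.turn hkC)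

/-- `Linked G S T`, for acyclic `G`: the sets `S` and `T` of equal size are linked by
vertex-disjoint directed paths from `S` to `T`. The paths are encoded by the map `σ` that sends
every vertex on a path to the next one and fixes the vertices lying on no path; it matches the
complement of `T` with that of `S`. -/
def Linked (G : Digraph V) (S T : Finset V) : Prop :=
  ∃ σ : V → V, Set.BijOn σ (↑T)ᶜ (↑S)ᶜ ∧ ∀ w ∉ T, σ w = w ∨ G.Adj w (σ w)

/-- A ball that reaches `b` from `a` given `C` yields disjoint paths from a common set to `{a} ∪ C`
and to `{b} ∪ C`. Both matchings are found at once by Hall's theorem: each vertex `u` of the first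
copy of `V` is either matched backwards along the first linkage or, if `u ∈ S`, with itself in the
second copy, which makes that copy of `u` unavailable to the second linkage. -/
theorem BayesBall.exists_linked [Fintype V] [DecidableEq V] {G : Digraph V} {C : Finset V}
    {a b : V} (ha : a ∉ C) (hb : b ∉ C) (h : BayesBall G C a false b) :
    ∃ S : Finset V, S.card = C.card + 1 ∧ Linked G S (insert a C) ∧ Linked G S (insert b C) := by
  classical
  -- The left summands carry the linkage to `{a} ∪ C`, read backwards, and the right summands the
  -- linkage to `{b} ∪ C`; the values `inr u` with `u ∈ S` are taken by the former.
  let t : V ⊕ {w // w ∉ insert b C} → Finset (V ⊕ V) := Sum.elim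
    (fun u => (Finset.univ.filter fun w => w ∉ insert a C ∧ (w = u ∨ G.Adj w u)).disjSum {u})
    (fun w => (∅ : Finset V).disjSum (Finset.univ.filter fun u => u = w.1 ∨ G.Adj w.1 u))
  obtain ⟨f, hf, hft⟩ := (Finset.all_card_le_biUnion_card_iff_exists_injective t).1 (by
    intro s
    by_contra! hlt
    set X₁ : Finset V := s.toLeft with hX₁
    set X₂ : Finset V := s.toRight.map (Function.Embedding.subtype _) with hX₂
    have hX₂b : ∀ w ∈ X₂, w ∉ insert b C := by
      intro w hw
      obtain ⟨w, -, rfl⟩ := Finset.mem_map.1 hw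
      exact w.2
    have hs : s.card = X₁.card + X₂.card := by
      rw [hX₂, Finset.card_map, Finset.card_toLeft_add_card_toRight]
    -- `X₁` and `X₂` are the two halves of a set violating Hall's condition, `P` the new parents of
    -- `X₁` and `Q` the new children of `X₂`. The violation leaves no slack in the count below: `P`
    -- and `Q` are empty, `X₁ ⊆ X₂ ∪ C` and `a ∈ X₁`.
    set P : Finset V := Finset.univ.filter fun w => w ∉ X₁ ∧ w ∉ insert a C ∧ ∃ u ∈ X₁, G.Adj w u
    set Q : Finset V := Finset.univ.filter fun w => w ∉ X₁ ∧ w ∉ X₂ ∧ ∃ u ∈ X₂, G.Adj u w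
    have hsub : (P ∪ (X₁ \ insert a C)).disjSum (Q ∪ (X₁ ∪ X₂)) ⊆ s.biUnion t := by
      intro x hx
      rw [Finset.mem_biUnion]
      rcases x with w | u
      · rw [Finset.inl_mem_disjSum, Finset.mem_union] at hx
        rcases hx with hx | hx
        · obtain ⟨-, -, hwa, u, hu, hwu⟩ := Finset.mem_filter.1 hx
          exact ⟨.inl u, Finset.mem_toLeft.1 hu, by simp [t, hwu]; simpa using hwa⟩
        · obtain ⟨hw, hwa⟩ := Finset.mem_sdiff.1 hx
          exact ⟨.inl w, Finset.mem_toLeft.1 hw, by simp [t]; simpa using hwa⟩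
      · rw [Finset.inr_mem_disjSum, Finset.mem_union, Finset.mem_union] at hx
        rcases hx with hx | hx | hx
        · obtain ⟨-, -, -, w, hw, hwu⟩ := Finset.mem_filter.1 hx
          obtain ⟨w, hw', rfl⟩ := Finset.mem_map.1 hw
          exact ⟨.inr w, Finset.mem_toRight.1 hw', by simpa [t] using Or.inr hwu⟩
        · exact ⟨.inl u, Finset.mem_toLeft.1 hx, by simp [t]⟩
        · obtain ⟨w, hw, rfl⟩ := Finset.mem_map.1 hx
          exact ⟨.inr w, Finset.mem_toRight.1 hw, by simp [t]⟩
    have hcard := (Finset.card_le_card hsub).trans_lt hlt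
    have hP : Disjoint P (X₁ \ insert a C) := Finset.disjoint_left.2 fun w hw hw' =>
      (Finset.mem_filter.1 hw).2.1 (Finset.mem_sdiff.1 hw').1
    have hQ : Disjoint Q (X₁ ∪ X₂) := Finset.disjoint_left.2 fun w hw hw' =>
      (Finset.mem_union.1 hw').elim (Finset.mem_filter.1 hw).2.1 (Finset.mem_filter.1 hw).2.2.1
    rw [Finset.card_disjSum, Finset.card_union_of_disjoint hP, Finset.card_union_of_disjoint hQ,
      hs] at hcard
    have e₁ : (X₁ \ X₂).card + X₂.card = (X₁ ∪ X₂).card := Finset.card_sdiff_add_card _ _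
    have e₂ : (X₁ \ insert a C).card + (X₁ ∩ insert a C).card = X₁.card :=
      Finset.card_sdiff_add_card_inter _ _
    have e₃ : (X₁ ∩ insert a C).card ≤ (X₁ ∩ {a}).card + (X₁ ∩ C).card := by
      rw [Finset.insert_eq, Finset.inter_union_distrib_left]
      exact Finset.card_union_le _ _
    have e₄ : (X₁ ∩ C).card + ((X₁ \ X₂) \ C).card ≤ (X₁ \ X₂).card := by
      rw [← Finset.card_union_of_disjoint]
      · refine Finset.card_le_card (Finset.union_subset ?_ Finset.sdiff_subset)
        intro w hw
        rw [Finset.mem_inter] at hw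
        exact Finset.mem_sdiff.2 ⟨hw.1, fun hw' => hX₂b w hw' (Finset.mem_insert_of_mem hw.2)⟩
      · exact Finset.disjoint_left.2 fun w hw hw' =>
          (Finset.mem_sdiff.1 hw').2 (Finset.mem_inter.1 hw).2
    have e₅ : (X₁ ∩ {a}).card ≤ 1 :=
      (Finset.card_le_card Finset.inter_subset_right).trans (by simp)
    have hP0 : P = ∅ := Finset.card_eq_zero.1 (by omega)
    have hQ0 : Q = ∅ := Finset.card_eq_zero.1 (by omega)
    have hX0 : (X₁ \ X₂) \ C = ∅ := Finset.card_eq_zero.1 (by omega)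
    have haX : a ∈ X₁ := by
      have : (X₁ ∩ {a}).Nonempty := Finset.card_pos.1 (by omega)
      obtain ⟨x, hx⟩ := this
      simp only [Finset.mem_inter, Finset.mem_singleton] at hx
      exact hx.2 ▸ hx.1
    have hX : ∀ w ∈ X₁, w ∉ C → w ∈ X₂ := by
      intro w hw hwC
      by_contra hw'
      have : w ∈ (X₁ \ X₂) \ C := by simp [hw, hw', hwC]
      simp [hX0] at this
    have hup : ∀ w u, u ∈ X₁ → G.Adj w u → w ∈ X₁ ∨ w ∈ C := by
      intro w u hu hwu
      by_contra! hw
      have : w ∈ P := Finset.mem_filter.2 ⟨Finset.mem_univ _, hw.1, by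
        rw [Finset.mem_insert]
        rintro (rfl | hw')
        exacts [hw.1 haX, hw.2 hw'], u, hu, hwu⟩
      simp [hP0] at this
    have hdown : ∀ w u, u ∈ X₂ → G.Adj u w → w ∈ X₁ ∨ w ∈ X₂ := by
      intro w u hu hwu
      by_contra! hw
      have : w ∈ Q := Finset.mem_filter.2 ⟨Finset.mem_univ _, hw.1, hw.2, u, hu, hwu⟩
      simp [hQ0] at this
    -- A violation of Hall's condition confines the ball.
    have key : ∀ d v, BayesBall G C a d v →
        (d = true → v ∈ X₁ ∨ v ∈ C) ∧ (d = false → v ∈ X₁ ∨ v ∈ X₂) := by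
      intro d v hv
      induction hv with
      | start => simp [haX]
      | up _ hv huv ih => simpa using hup _ _ ((ih.1 rfl).resolve_right hv) huv
      | turn _ hv ih => simpa using Or.inl ((ih.1 rfl).resolve_right hv)
      | down _ hv hvw ih =>
        simpa using hdown _ _ ((ih.2 rfl).elim (fun h' => hX _ h' hv) id) hvw
      | bounce _ hv huv ih =>
        simpa using hup _ _ ((ih.2 rfl).resolve_right
          fun h' => hX₂b _ h' (Finset.mem_insert_of_mem hv)) huv
    have hbX : b ∈ X₂ := ((key false b h).2 rfl).elim (fun h' => hX _ h' hb) id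
    exact hX₂b b hbX (Finset.mem_insert_self _ _))
  set S : Finset V := Finset.univ.filter fun u => f (.inl u) = .inr u with hS
  have hg : ∀ u, ∃ w, u ∉ S → f (.inl u) = .inl w ∧ w ∉ insert a C ∧ (w = u ∨ G.Adj w u) := by
    intro u
    by_cases hu : u ∈ S
    · exact ⟨u, fun h' => absurd hu h'⟩
    have := hft (.inl u)
    rcases hfu : f (.inl u) with w | w
    · rw [hfu] at this
      refine ⟨w, fun _ => ⟨rfl, ?_⟩⟩
      simpa only [t, Sum.elim_inl, Finset.inl_mem_disjSum, Finset.mem_filter, Finset.mem_univ,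
        true_and] using this
    · rw [hfu] at this
      simp only [t, Sum.elim_inl, Finset.inr_mem_disjSum, Finset.mem_singleton] at this
      exact absurd (Finset.mem_filter.2 ⟨Finset.mem_univ _, this ▸ hfu⟩) hu
  choose g hg using hg
  have hh : ∀ w, ∃ u, ∀ hw : w ∉ insert b C,
      f (.inr ⟨w, hw⟩) = .inr u ∧ u ∉ S ∧ (u = w ∨ G.Adj w u) := by
    intro w
    by_cases hw : w ∈ insert b C
    · exact ⟨w, fun h' => absurd hw h'⟩
    have := hft (.inr ⟨w, hw⟩)
    rcases hfu : f (.inr ⟨w, hw⟩) with u | u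
    · rw [hfu] at this
      simp [t] at this
    · rw [hfu] at this
      refine ⟨u, fun _ => ⟨hfu, ?_, ?_⟩⟩
      · intro hu
        have := hf (hfu.trans (Finset.mem_filter.1 hu).2.symm)
        simp at this
      · simpa only [t, Sum.elim_inr, Finset.inr_mem_disjSum, Finset.mem_filter, Finset.mem_univ,
          true_and] using this
  choose k hk using hh
  -- Both maps are injective, and `{a} ∪ C` and `{b} ∪ C` have the same size, so both are bijective.
  have hgi : Set.InjOn g (↑(Sᶜ) : Set V) := by
    intro u hu v hv huv
    have hu' := (hg u (by simpa using hu)).1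
    have hv' := (hg v (by simpa using hv)).1
    rw [huv, ← hv'] at hu'
    simpa using hf hu'
  have hki : Set.InjOn k (↑((insert b C)ᶜ) : Set V) := by
    intro u hu v hv huv
    have hu' := (hk u (Finset.mem_compl.1 hu)).1
    have hv' := (hk v (Finset.mem_compl.1 hv)).1
    rw [huv, ← hv'] at hu'
    simpa using hf hu'
  have hgm : Set.MapsTo g (↑(Sᶜ) : Set V) ↑((insert a C)ᶜ) := fun u hu =>
    Finset.mem_coe.2 (Finset.mem_compl.2 (hg u (by simpa using hu)).2.1)
  have hkm : Set.MapsTo k (↑((insert b C)ᶜ) : Set V) ↑(Sᶜ) := fun w hw =>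
    Finset.mem_coe.2 (Finset.mem_compl.2 (hk w (Finset.mem_compl.1 hw)).2.1)
  have c₁ := Finset.card_le_card_of_injOn g hgm hgi
  have c₂ := Finset.card_le_card_of_injOn k hkm hki
  have c₃ : (insert a C)ᶜ.card = (insert b C)ᶜ.card := by
    rw [Finset.card_compl, Finset.card_compl, Finset.card_insert_of_notMem ha,
      Finset.card_insert_of_notMem hb]
  have hgs : Set.SurjOn g (↑(Sᶜ) : Set V) ↑((insert a C)ᶜ) :=
    Finset.surjOn_of_injOn_of_card_le g hgm hgi (by omega)
  have hks : Set.SurjOn k (↑((insert b C)ᶜ) : Set V) ↑(Sᶜ) :=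
    Finset.surjOn_of_injOn_of_card_le k hkm hki (by omega)
  have hgb : Set.BijOn g (↑(Sᶜ) : Set V) ↑((insert a C)ᶜ) := ⟨hgm, hgi, hgs⟩
  refine ⟨S, ?_, ?_, k, ?_, ?_⟩
  · have := Finset.card_compl_add_card S
    have := Finset.card_compl_add_card (insert a C)
    have := Finset.card_insert_of_notMem ha
    omega
  · have : Nonempty V := ⟨a⟩
    refine ⟨Function.invFunOn g (↑(Sᶜ) : Set V), ?_, ?_⟩
    · simpa only [Finset.coe_compl] using Set.BijOn.symm hgb.invOn_invFunOn.symm hgb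
    · intro w hw
      have hw' : w ∈ (↑((insert a C)ᶜ) : Set V) :=
        Finset.mem_coe.2 (Finset.mem_compl.2 hw)
      have h₁ : Function.invFunOn g (↑(Sᶜ) : Set V) w ∈ (↑(Sᶜ) : Set V) :=
        Function.invFunOn_mem (hgs hw')
      have h₂ : g (Function.invFunOn g (↑(Sᶜ) : Set V) w) = w := Function.invFunOn_eq (hgs hw')
      have h₃ := (hg _ (Finset.mem_compl.1 (Finset.mem_coe.1 h₁))).2.2
      rw [h₂] at h₃
      exact h₃.imp Eq.symm id
  · have hkb : Set.BijOn k (↑((insert b C)ᶜ) : Set V) ↑(Sᶜ) := ⟨hkm, hki, hks⟩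
    simpa only [Finset.coe_compl] using hkb
  · exact fun w hw => (hk w hw).2.2

/-! ### Nonsingular covariance blocks from linkages -/

theorem IsAcyclic.wellFounded_transGen [Finite V] {G : Digraph V} (hG : IsAcyclic G) :
    WellFounded (Relation.TransGen G.Adj) :=
  have : Std.Irrefl (Relation.TransGen G.Adj) := ⟨hG⟩
  Finite.wellFounded_of_trans_of_irrefl _

theorem IsAcyclic.wellFounded [Finite V] {G : Digraph V} (hG : IsAcyclic G) :
    WellFounded G.Adj :=
  Subrelation.wf (fun h => .single h) hG.wellFounded_transGen

theorem IsAcyclic.wellFounded_swap [Finite V] {G : Digraph V} (hG : IsAcyclic G) :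
    WellFounded (Function.swap G.Adj) := by
  have : Std.Irrefl (Function.swap (Relation.TransGen G.Adj)) := ⟨hG⟩
  have : IsTrans V (Function.swap (Relation.TransGen G.Adj)) := ⟨fun _ _ _ h₁ h₂ => h₂.trans h₁⟩
  exact Subrelation.wf (fun h => .single h)
    (Finite.wellFounded_of_trans_of_irrefl (Function.swap (Relation.TransGen G.Adj)))

section LinearAlgebra

open Matrix

variable [Fintype V] [DecidableEq V]

theorem IsAcyclic.det_one_sub_ne_zero {G : Digraph V} (hG : IsAcyclic G) {L : Matrix V V ℝ}
    (hL : ∀ i j, ¬ G.Adj i j → L i j = 0) : (1 - L).det ≠ 0 := by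
  intro h0
  obtain ⟨x, hx, hx0⟩ := Matrix.exists_vecMul_eq_zero_iff.2 h0
  refine hx (funext fun v => ?_)
  induction v using hG.wellFounded.induction with
  | _ v ih =>
    have h := congrFun hx0 v
    rw [Matrix.vecMul_sub, Matrix.vecMul_one, Pi.sub_apply, Pi.zero_apply, sub_eq_zero] at h
    rw [h, Matrix.vecMul, dotProduct]
    refine Finset.sum_eq_zero fun w _ => ?_
    by_cases hw : G.Adj w v
    · rw [ih w hw, Pi.zero_apply, zero_mul]
    · rw [hL w v hw, mul_zero]

/-- Weights `1` on the edges of a linkage and `0` elsewhere make the block of `(1 - L)⁻¹` with rows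
`S` and columns `T` nonsingular. This is phrased for `y = x (1 - L)⁻¹` with `x` supported on `S`: if
`y` vanishes on `T`, then it vanishes along each path, from its end point backwards. -/
theorem Linked.exists_weights {G : Digraph V} (hG : IsAcyclic G) {S T : Finset V}
    (h : Linked G S T) :
    ∃ L : Matrix V V ℝ, (∀ i j, ¬ G.Adj i j → L i j = 0) ∧
      ∀ y : V → ℝ, (∀ t ∈ T, y t = 0) → (∀ u ∉ S, (y ᵥ* (1 - L)) u = 0) → y = 0 := by
  obtain ⟨σ, hσ, hadj⟩ := h
  classical
  refine ⟨.of fun w u => if w ∉ T ∧ σ w = u ∧ w ≠ u then 1 else 0, ?_, ?_⟩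
  · intro w u hwu
    refine if_neg ?_
    rintro ⟨hw, rfl, hne⟩
    exact hwu ((hadj w hw).resolve_left (Ne.symm hne))
  · intro y hyT hyS
    funext w
    induction w using hG.wellFounded_swap.induction with
    | _ w ih =>
      by_cases hw : w ∈ T
      · exact hyT w hw
      have hσw : σ w ∉ S := by simpa using hσ.mapsTo (show w ∈ (↑T : Set V)ᶜ by simpa using hw)
      have h := hyS (σ w) hσw
      rw [Matrix.vecMul_sub, Matrix.vecMul_one, Pi.sub_apply, sub_eq_zero, Matrix.vecMul,
        dotProduct] at h
      simp only [Matrix.of_apply] at h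
      rw [Finset.sum_eq_single w] at h
      · rcases hadj w hw with he | he
        · simpa [he] using h
        · rw [ih _ he] at h
          have hne : w ≠ σ w := fun h' => hG w (by
            rw [← h'] at he
            exact .single he)
          simpa [hw, hne] using h.symm
      · intro v _ hv
        rw [if_neg, mul_zero]
        rintro ⟨hvT, hvw, -⟩
        exact hv (hσ.injOn (by simpa using hvT) (by simpa using hw) hvw)
      · simp

/-- The kernel condition of `Linked.exists_weights` as a determinant. The adjugate replaces the
inverse so that the determinant is a polynomial in the entries of `L`. -/
theorem det_submatrix_adjugate_ne_zero {I : Type*} [Fintype I] [DecidableEq I] {L : Matrix V V ℝ}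
    (hdet : (1 - L).det ≠ 0) {s r : I → V} (hs : Function.Injective s)
    (h : ∀ y : V → ℝ, (∀ i, y (r i) = 0) → (∀ u, u ∉ Set.range s → (y ᵥ* (1 - L)) u = 0) → y = 0) :
    (((1 - L).adjugate).submatrix s r).det ≠ 0 := by
  intro h0
  obtain ⟨x, hx, hx0⟩ := Matrix.exists_vecMul_eq_zero_iff.2 h0
  set z : V → ℝ := Function.extend s x 0 with hz
  have hzM : z ᵥ* (1 - L).adjugate ᵥ* (1 - L) = (1 - L).det • z := by
    rw [Matrix.vecMul_vecMul, Matrix.adjugate_mul, Matrix.vecMul_smul, Matrix.vecMul_one]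
  have hsum : ∀ v, (z ᵥ* (1 - L).adjugate) v = ∑ i, x i * (1 - L).adjugate (s i) v := by
    intro v
    rw [Matrix.vecMul, dotProduct]
    refine (Fintype.sum_of_injective s hs _ _ (fun u hu => ?_) fun i => ?_).symm
    · rw [hz, Function.extend_apply' _ _ _ (by simpa using hu), Pi.zero_apply, zero_mul]
    · rw [hz, hs.extend_apply]
  have hy := h (z ᵥ* (1 - L).adjugate) (fun i => by
    rw [hsum]
    exact congrFun hx0 i) (fun u hu => by
    rw [hzM, Pi.smul_apply, hz, Function.extend_apply' _ _ _ (by simpa using hu), Pi.zero_apply,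
      smul_zero])
  rw [hy, Matrix.zero_vecMul] at hzM
  refine hx (funext fun i => ?_)
  have := congrFun hzM (s i)
  rw [Pi.zero_apply, Pi.smul_apply, hz, hs.extend_apply, smul_eq_mul] at this
  exact (mul_eq_zero.1 this.symm).resolve_left hdet

open Polynomial in
theorem exists_common_weights {I : Type*} [Fintype I] [DecidableEq I] (L₁ L₂ : Matrix V V ℝ)
    {s r₁ r₂ : I → V} (h₁ : (((1 - L₁).adjugate).submatrix s r₁).det ≠ 0)
    (h₂ : (((1 - L₂).adjugate).submatrix s r₂).det ≠ 0) :
    ∃ t : ℝ, (((1 - (L₁ + t • (L₂ - L₁))).adjugate).submatrix s r₁).det ≠ 0 ∧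
      (((1 - (L₁ + t • (L₂ - L₁))).adjugate).submatrix s r₂).det ≠ 0 := by
  -- The matrix `1 - L` for `L` on the line through `L₁` and `L₂`, with the parameter as variable.
  let M : Matrix V V ℝ[X] := 1 - (L₁.map C + (X : ℝ[X]) • (L₂ - L₁).map C)
  have hM : ∀ (t : ℝ) (r : I → V), (((M.adjugate).submatrix s r).det).eval t =
      (((1 - (L₁ + t • (L₂ - L₁))).adjugate).submatrix s r).det := by
    intro t r
    rw [← coe_evalRingHom, RingHom.map_det, RingHom.mapMatrix_apply, ← Matrix.submatrix_map,
      ← RingHom.mapMatrix_apply, RingHom.map_adjugate]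
    congr 3
    ext i j
    by_cases hij : i = j <;> simp [M, hij]
  have hne : ((M.adjugate).submatrix s r₁).det * ((M.adjugate).submatrix s r₂).det ≠ 0 := by
    refine mul_ne_zero (fun h => h₁ ?_) (fun h => h₂ ?_)
    · simpa [h] using (hM 0 r₁).symm
    · simpa [h] using (hM 1 r₂).symm
  obtain ⟨t, ht⟩ : ∃ t, (((M.adjugate).submatrix s r₁).det *
      ((M.adjugate).submatrix s r₂).det).eval t ≠ 0 := by
    by_contra! hall
    exact hne (Polynomial.funext fun t => by rw [hall t, eval_zero])
  rw [eval_mul, hM, hM] at ht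
  exact ⟨t, left_ne_zero_of_mul ht, right_ne_zero_of_mul ht⟩

/-- For variances equal to the indicator of the range of `s` the block is the product of the two
given nonsingular matrices; by continuity nonsingularity persists when a small positive constant is
added to all variances. -/
theorem exists_variances {I : Type*} [Fintype I] [DecidableEq I] (N : Matrix V V ℝ)
    {s r₁ r₂ : I → V} (hs : Function.Injective s) (h₁ : (N.submatrix s r₁).det ≠ 0)
    (h₂ : (N.submatrix s r₂).det ≠ 0) :
    ∃ φ : V → ℝ, (∀ v, 0 < φ v) ∧ ((Nᵀ * diagonal φ * N).submatrix r₁ r₂).det ≠ 0 := by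
  classical
  let φ : ℝ → V → ℝ := fun δ v => (if v ∈ Set.range s then 1 else 0) + δ
  have h0 : ((Nᵀ * diagonal (φ 0) * N).submatrix r₁ r₂) =
      (N.submatrix s r₁)ᵀ * N.submatrix s r₂ := by
    ext i j
    rw [Matrix.submatrix_apply, Matrix.mul_apply, Matrix.mul_apply]
    simp only [Matrix.mul_diagonal, Matrix.transpose_apply, Matrix.submatrix_apply, φ, add_zero]
    refine (Fintype.sum_of_injective s hs _ _ (fun u hu => ?_) fun i => ?_).symm
    · rw [if_neg hu, mul_zero, zero_mul]
    · rw [if_pos (Set.mem_range_self i), mul_one]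
  have hc : Continuous fun δ => ((Nᵀ * diagonal (φ δ) * N).submatrix r₁ r₂).det := by
    refine Continuous.matrix_det (Continuous.matrix_submatrix ?_ _ _)
    refine Continuous.matrix_mul (Continuous.matrix_mul continuous_const ?_) continuous_const
    refine Continuous.matrix_diagonal (continuous_pi fun v => ?_)
    exact continuous_const.add continuous_id
  have hev : ∀ᶠ δ in nhds (0 : ℝ), ((Nᵀ * diagonal (φ δ) * N).submatrix r₁ r₂).det ≠ 0 := by
    refine hc.continuousAt.eventually_ne ?_
    rw [h0, Matrix.det_mul, Matrix.det_transpose]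
    exact mul_ne_zero h₁ h₂
  obtain ⟨δ, hδ, hδ0⟩ := ((hev.filter_mono nhdsWithin_le_nhds).and
    (self_mem_nhdsWithin (a := (0 : ℝ)) (s := Set.Ioi 0))).exists
  refine ⟨φ δ, fun v => ?_, hδ⟩
  have : (0 : ℝ) < δ := hδ0
  by_cases hv : v ∈ Set.range s <;> simp only [φ, hv, if_true, if_false] <;> linarith

/-- The covariance matrix of the model with edge weights `L` and error variances `φ`. -/
noncomputable def covMatrix (L : Matrix V V ℝ) (φ : V → ℝ) : Matrix V V ℝ :=
  ((1 - L)⁻¹)ᵀ * diagonal φ * (1 - L)⁻¹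

/-- If the ball reaches `b` from `a`, then for some parameters of the model the covariance block
with rows `{a} ∪ C` and columns `{b} ∪ C` has trivial left kernel. The vectors `α` are indexed by
all of `V` and supported on the rows. -/
theorem BayesBall.exists_nonsingular {G : Digraph V} (hG : IsAcyclic G) {C : Finset V} {a b : V}
    (ha : a ∉ C) (hb : b ∉ C) (h : BayesBall G C a false b) :
    ∃ (L : Matrix V V ℝ) (φ : V → ℝ), (∀ i j, ¬ G.Adj i j → L i j = 0) ∧ (∀ v, 0 < φ v) ∧
      ∀ α : V → ℝ, (∀ v ∉ insert a C, α v = 0) →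
        (∀ v ∈ insert b C, (α ᵥ* covMatrix L φ) v = 0) → α = 0 := by
  obtain ⟨S, hS, hSa, hSb⟩ := h.exists_linked ha hb
  obtain ⟨L₁, hL₁, hk₁⟩ := hSa.exists_weights hG
  obtain ⟨L₂, hL₂, hk₂⟩ := hSb.exists_weights hG
  have hcard : Fintype.card (Option C) = Fintype.card S := by simp [hS]
  let e := Fintype.equivOfCardEq hcard
  let s : Option C → V := fun i => (e i : V)
  have hs : Function.Injective s := Subtype.val_injective.comp e.injective
  have hrs : Set.range s = S := by
    rw [show s = Subtype.val ∘ e from rfl, e.surjective.range_comp]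
    simp
  -- For `x = a` and `x = b` this enumerates `{x} ∪ C`, with `x` at index `none`.
  let r : V → Option C → V := fun x i => i.elim x Subtype.val
  have hr : ∀ x v, v ∈ insert x C ↔ ∃ i, r x i = v := by
    intro x v
    simp [r, Option.exists, eq_comm]
  obtain ⟨t, ht₁, ht₂⟩ := exists_common_weights L₁ L₂ (s := s) (r₁ := r a) (r₂ := r b)
    (det_submatrix_adjugate_ne_zero (hG.det_one_sub_ne_zero hL₁) hs fun y hy hy' =>
      hk₁ y (fun v hv => by obtain ⟨i, rfl⟩ := (hr a v).1 hv; exact hy i)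
        fun u hu => hy' u (by rwa [hrs]))
    (det_submatrix_adjugate_ne_zero (hG.det_one_sub_ne_zero hL₂) hs fun y hy hy' =>
      hk₂ y (fun v hv => by obtain ⟨i, rfl⟩ := (hr b v).1 hv; exact hy i)
        fun u hu => hy' u (by rwa [hrs]))
  set L := L₁ + t • (L₂ - L₁) with hLdef
  have hL : ∀ i j, ¬ G.Adj i j → L i j = 0 := fun i j hij => by
    simp [hLdef, hL₁ i j hij, hL₂ i j hij]
  obtain ⟨φ, hφ, hdet⟩ := exists_variances (1 - L).adjugate hs ht₁ ht₂
  have hd := hG.det_one_sub_ne_zero hL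
  have hadj : (1 - L).adjugate = (1 - L).det • (1 - L)⁻¹ := by
    rw [Matrix.inv_def, smul_smul, Ring.mul_inverse_cancel _ (isUnit_iff_ne_zero.2 hd), one_smul]
  refine ⟨L, φ, hL, hφ, fun α hα h0 => ?_⟩
  have hri : Function.Injective (r a) := by
    rintro (_ | i) (_ | j) hij
    · rfl
    · exact absurd (show a = j from hij) fun h' => ha (h' ▸ j.2)
    · exact absurd (show (i : V) = a from hij) fun h' => ha (h' ▸ i.2)
    · exact congrArg some (Subtype.ext hij)
  have hx : α ∘ r a = 0 := by
    by_contra hne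
    refine hdet (Matrix.exists_vecMul_eq_zero_iff.1 ⟨α ∘ r a, hne, funext fun j => ?_⟩)
    have h1 := h0 (r b j) ((hr b _).2 ⟨j, rfl⟩)
    rw [hadj, Matrix.transpose_smul, Matrix.smul_mul, Matrix.mul_smul, Matrix.smul_mul,
      ← covMatrix]
    rw [Matrix.vecMul, dotProduct] at h1 ⊢
    simp only [Matrix.submatrix_apply, Matrix.smul_apply, smul_eq_mul, Function.comp_apply,
      Pi.zero_apply]
    have h2 : ∑ i, α (r a i) * covMatrix L φ (r a i) (r b j) = 0 := by
      rw [← h1]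
      refine Fintype.sum_of_injective (r a) hri _ _ (fun u hu => ?_) fun i => rfl
      rw [hα u fun hu' => hu ((hr a u).1 hu'), zero_mul]
    calc _ = (1 - L).det * ((1 - L).det *
          ∑ i, α (r a i) * covMatrix L φ (r a i) (r b j)) := by
          rw [Finset.mul_sum, Finset.mul_sum]
          exact Finset.sum_congr rfl fun i _ => by ring
      _ = 0 := by rw [h2, mul_zero, mul_zero]
  funext v
  by_cases hv : v ∈ insert a C
  · obtain ⟨i, rfl⟩ := (hr a v).1 hv
    exact congrFun hx i
  · exact hα v hv

end LinearAlgebra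

/-! ### Conditional independence of σ-algebras -/

section ConditionalIndependence

variable {Ω : Type*}

theorem isPiSystem_image2_inter (m₁ m₂ : MeasurableSpace Ω) :
    IsPiSystem (Set.image2 (· ∩ ·) {s | MeasurableSet[m₁] s} {s | MeasurableSet[m₂] s}) := by
  rintro _ ⟨s₁, hs₁, t₁, ht₁, rfl⟩ _ ⟨s₂, hs₂, t₂, ht₂, rfl⟩ -
  exact ⟨s₁ ∩ s₂, MeasurableSet.inter hs₁ hs₂, t₁ ∩ t₂, MeasurableSet.inter ht₁ ht₂,
    Set.inter_inter_inter_comm _ _ _ _⟩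

theorem generateFrom_image2_inter (m₁ m₂ : MeasurableSpace Ω) :
    MeasurableSpace.generateFrom
      (Set.image2 (· ∩ ·) {s | MeasurableSet[m₁] s} {s | MeasurableSet[m₂] s}) = m₁ ⊔ m₂ := by
  refine le_antisymm (MeasurableSpace.generateFrom_le ?_) (sup_le ?_ ?_)
  · rintro _ ⟨s, hs, t, ht, rfl⟩
    exact MeasurableSet.inter ((le_sup_left : m₁ ≤ m₁ ⊔ m₂) _ hs)
      ((le_sup_right : m₂ ≤ m₁ ⊔ m₂) _ ht)
  · exact fun s hs => MeasurableSpace.measurableSet_generateFrom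
      ⟨s, hs, Set.univ, MeasurableSet.univ, Set.inter_univ s⟩
  · exact fun s hs => MeasurableSpace.measurableSet_generateFrom
      ⟨Set.univ, MeasurableSet.univ, s, hs, Set.univ_inter s⟩

variable {m' m₁ m₂ mΩ : MeasurableSpace Ω} {μ : Measure Ω}

theorem integral_mul_of_indep (hm₁ : m₁ ≤ mΩ) (hm₂ : m₂ ≤ mΩ) (h : Indep m₁ m₂ μ) {f g : Ω → ℝ}
    (hf : StronglyMeasurable[m₁] f) (hg : StronglyMeasurable[m₂] g) :
    ∫ ω, f ω * g ω ∂μ = (∫ ω, f ω ∂μ) * ∫ ω, g ω ∂μ := by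
  have hfg : IndepFun f g μ :=
    indep_of_indep_of_le_left (indep_of_indep_of_le_right h hg.measurable.comap_le)
      hf.measurable.comap_le
  exact hfg.integral_fun_mul_eq_mul_integral (hf.mono hm₁).aestronglyMeasurable
    (hg.mono hm₂).aestronglyMeasurable

theorem integrable_mul_of_indep (h : Indep m₁ m₂ μ) {f g : Ω → ℝ}
    (hf : StronglyMeasurable[m₁] f) (hg : StronglyMeasurable[m₂] g) (hfi : Integrable f μ)
    (hgi : Integrable g μ) : Integrable (fun ω => f ω * g ω) μ := by
  have hfg : IndepFun f g μ :=
    indep_of_indep_of_le_left (indep_of_indep_of_le_right h hg.measurable.comap_le)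
      hf.measurable.comap_le
  exact hfg.integrable_mul hfi hgi

/-- Conditioning a product of two independent variables on a σ-algebra generated by information
about each factor separately. -/
theorem condExp_mul_of_indep [IsProbabilityMeasure μ] {g₁ g₂ : MeasurableSpace Ω}
    (hm₁ : m₁ ≤ mΩ) (hm₂ : m₂ ≤ mΩ) (h : Indep m₁ m₂ μ) (hg₁ : g₁ ≤ m₁) (hg₂ : g₂ ≤ m₂)
    {f g : Ω → ℝ} (hf : StronglyMeasurable[m₁] f) (hg : StronglyMeasurable[m₂] g)
    (hfi : Integrable f μ) (hgi : Integrable g μ) :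
    μ[fun ω => f ω * g ω | g₁ ⊔ g₂] =ᵐ[μ] fun ω => (μ[f | g₁]) ω * (μ[g | g₂]) ω := by
  have hle : g₁ ⊔ g₂ ≤ mΩ := sup_le (hg₁.trans hm₁) (hg₂.trans hm₂)
  have hF : StronglyMeasurable[m₁] (μ[f | g₁]) := stronglyMeasurable_condExp.mono hg₁
  have hG : StronglyMeasurable[m₂] (μ[g | g₂]) := stronglyMeasurable_condExp.mono hg₂
  have hint := integrable_mul_of_indep h hf hg hfi hgi
  have hint' := integrable_mul_of_indep h hF hG integrable_condExp integrable_condExp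
  have huniv : ∀ {p q : Ω → ℝ}, StronglyMeasurable[m₁] p → StronglyMeasurable[m₂] q →
      ∀ s t, MeasurableSet[g₁] s → MeasurableSet[g₂] t →
      ∫ ω in s ∩ t, p ω * q ω ∂μ = (∫ ω in s, p ω ∂μ) * ∫ ω in t, q ω ∂μ := by
    intro p q hp hq s t hs ht
    have hs' := hm₁ _ (hg₁ _ hs)
    have ht' := hm₂ _ (hg₂ _ ht)
    rw [← integral_indicator (hs'.inter ht'), ← integral_indicator hs', ← integral_indicator ht',
      ← integral_mul_of_indep hm₁ hm₂ h (hp.indicator (hg₁ _ hs)) (hq.indicator (hg₂ _ ht))]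
    simp only [Set.inter_indicator_mul]
  refine (ae_eq_condExp_of_forall_setIntegral_eq hle hint (fun s _ _ => hint'.integrableOn) ?_
    ?_).symm
  -- Both sides are finite signed measures of `s`, so the π-system of sets `s ∩ t` with `s`
  -- measurable for `g₁` and `t` for `g₂` suffices.
  · intro s hs _
    induction s, hs using MeasurableSpace.induction_on_inter
      (generateFrom_image2_inter g₁ g₂).symm (isPiSystem_image2_inter g₁ g₂) with
    | empty => simp
    | basic u hu =>
      obtain ⟨s, hs, t, ht, rfl⟩ := hu
      rw [huniv hF hG s t hs ht, huniv hf hg s t hs ht, setIntegral_condExp (hg₁.trans hm₁) hfi hs,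
        setIntegral_condExp (hg₂.trans hm₂) hgi ht]
    | compl u hu ih =>
      have htot : ∫ ω, (μ[f | g₁]) ω * (μ[g | g₂]) ω ∂μ = ∫ ω, f ω * g ω ∂μ := by
        rw [integral_mul_of_indep hm₁ hm₂ h hF hG, integral_mul_of_indep hm₁ hm₂ h hf hg,
          integral_condExp (hg₁.trans hm₁), integral_condExp (hg₂.trans hm₂)]
      rw [setIntegral_compl (hle _ hu) hint', setIntegral_compl (hle _ hu) hint, htot,
        ih (measure_lt_top _ _)]
    | iUnion u hd hu ih =>
      rw [integral_iUnion (fun i => hle _ (hu i)) hd hint'.integrableOn,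
        integral_iUnion (fun i => hle _ (hu i)) hd hint.integrableOn]
      exact tsum_congr fun i => ih i (measure_lt_top _ _)
  · exact ((stronglyMeasurable_condExp.mono le_sup_left).mul
      (stronglyMeasurable_condExp.mono le_sup_right)).aestronglyMeasurable

variable [StandardBorelSpace Ω]

/-- The conditioning σ-algebra may be joined to one side of a conditional independence. -/
theorem condIndep_sup_left [IsFiniteMeasure μ] {hm' : m' ≤ mΩ} (hm₁ : m₁ ≤ mΩ) (hm₂ : m₂ ≤ mΩ)
    (h : CondIndep m' m₁ m₂ hm' μ) : CondIndep m' (m₁ ⊔ m') m₂ hm' μ := by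
  have hi := (condIndep_iff m' m₁ m₂ hm' hm₁ hm₂ μ).1 h
  have hp : ∀ s ∈ Set.image2 (· ∩ ·) {s | MeasurableSet[m₁] s} {s | MeasurableSet[m'] s},
      MeasurableSet[mΩ] s := by
    rintro _ ⟨s, hs, t, ht, rfl⟩
    exact MeasurableSet.inter (hm₁ _ hs) (hm' _ ht)
  refine CondIndepSets.condIndep (sup_le hm₁ hm') hm₂ (isPiSystem_image2_inter m₁ m')
    (@MeasurableSpace.isPiSystem_measurableSet _ m₂) (generateFrom_image2_inter m₁ m').symm
    (@MeasurableSpace.generateFrom_measurableSet _ m₂).symm ?_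
  refine (condIndepSets_iff m' hm' _ _ hp (fun s hs => hm₂ s hs) μ).2 ?_
  rintro _ t ⟨s, hs, g, hg, rfl⟩ ht
  have hind : ∀ u, MeasurableSet[mΩ] u →
      μ⟦u ∩ g | m'⟧ =ᵐ[μ] g.indicator (μ⟦u | m'⟧) := fun u hu => by
    have := condExp_indicator (μ := μ) (m := m')
      ((integrable_const (1 : ℝ)).indicator hu) hg
    rwa [Set.indicator_indicator, Set.inter_comm] at this
  have hst : s ∩ g ∩ t = s ∩ t ∩ g := Set.inter_right_comm _ _ _
  simp only [hst]
  filter_upwards [hind s (hm₁ _ hs), hind (s ∩ t) (MeasurableSet.inter (hm₁ _ hs) (hm₂ _ ht)),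
    hi s t hs ht] with ω h₁ h₂ h₃
  rw [h₂, Pi.mul_apply, h₁]
  by_cases hω : ω ∈ g
  · rw [Set.indicator_of_mem hω, Set.indicator_of_mem hω, h₃, Pi.mul_apply]
  · rw [Set.indicator_of_notMem hω, Set.indicator_of_notMem hω, zero_mul]

theorem condIndep_sup_sup [IsFiniteMeasure μ] {hm' : m' ≤ mΩ} (hm₁ : m₁ ≤ mΩ) (hm₂ : m₂ ≤ mΩ)
    (h : CondIndep m' m₁ m₂ hm' μ) : CondIndep m' (m₁ ⊔ m') (m₂ ⊔ m') hm' μ :=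
  (condIndep_sup_left hm₂ (sup_le hm₁ hm') (condIndep_sup_left hm₁ hm₂ h).symm).symm

/-- Contraction: a σ-algebra that is conditionally independent of `m₂` given `m'` and independent of
`m'` is independent of `m₂`. -/
theorem indep_of_condIndep [IsProbabilityMeasure μ] {hm' : m' ≤ mΩ} (hm₁ : m₁ ≤ mΩ)
    (hm₂ : m₂ ≤ mΩ) (h : CondIndep m' m₁ m₂ hm' μ) (h₁ : Indep m₁ m' μ) : Indep m₁ m₂ μ := by
  rw [Indep_iff]
  intro s t hs ht
  have hi := (condIndep_iff m' m₁ m₂ hm' hm₁ hm₂ μ).1 h s t hs ht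
  have hc : μ⟦s | m'⟧ =ᵐ[μ] fun _ => μ.real s := by
    have := condExp_indep_eq hm₁ hm' (f := s.indicator fun _ => (1 : ℝ))
      ((@stronglyMeasurable_const _ _ m₁ _ _).indicator hs) h₁
    simpa [integral_indicator (hm₁ _ hs)] using this
  have hst : MeasurableSet[mΩ] (s ∩ t) := MeasurableSet.inter (hm₁ _ hs) (hm₂ _ ht)
  have hreal : ∀ u, MeasurableSet[mΩ] u → ∫ ω, (μ⟦u | m'⟧) ω ∂μ = μ.real u := fun u hu => by
    rw [integral_condExp hm', integral_indicator hu]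
    simp
  have hprod : μ.real (s ∩ t) = μ.real s * μ.real t := by
    rw [← hreal _ hst, integral_congr_ae hi, ← hreal t (hm₂ _ ht), ← integral_const_mul]
    refine integral_congr_ae ?_
    filter_upwards [hc] with ω hω
    rw [Pi.mul_apply, hω]
  rw [measureReal_def, measureReal_def, measureReal_def, ← ENNReal.toReal_mul] at hprod
  exact (ENNReal.toReal_eq_toReal_iff' (measure_ne_top _ _)
    (ENNReal.mul_ne_top (measure_ne_top _ _) (measure_ne_top _ _))).1 hprod

/-- Independent σ-algebras remain independent after conditioning on the join of a sub-σ-algebra of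
the one and a sub-σ-algebra of the other. -/
theorem condIndep_sup_of_indep [IsProbabilityMeasure μ] {g₁ g₂ : MeasurableSpace Ω}
    (hm₁ : m₁ ≤ mΩ) (hm₂ : m₂ ≤ mΩ) (h : Indep m₁ m₂ μ) (hg₁ : g₁ ≤ m₁) (hg₂ : g₂ ≤ m₂) :
    CondIndep (g₁ ⊔ g₂) m₁ m₂ (sup_le (hg₁.trans hm₁) (hg₂.trans hm₂)) μ := by
  rw [condIndep_iff _ _ _ _ hm₁ hm₂]
  intro s t hs ht
  have hmeas : ∀ (m : MeasurableSpace Ω) (u : Set Ω), MeasurableSet[m] u →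
      StronglyMeasurable[m] (u.indicator fun _ => (1 : ℝ)) := fun m u hu =>
    (@stronglyMeasurable_const _ _ m _ _).indicator hu
  have hint : ∀ u : Set Ω, MeasurableSet[mΩ] u → Integrable (u.indicator fun _ => (1 : ℝ)) μ :=
    fun u hu => (integrable_const _).indicator hu
  have key : ∀ s t, MeasurableSet[m₁] s → MeasurableSet[m₂] t →
      μ⟦s ∩ t | g₁ ⊔ g₂⟧ =ᵐ[μ] fun ω => (μ⟦s | g₁⟧) ω * (μ⟦t | g₂⟧) ω := by
    intro s t hs ht
    have := condExp_mul_of_indep hm₁ hm₂ h hg₁ hg₂ (hmeas m₁ s hs) (hmeas m₂ t ht)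
      (hint s (hm₁ _ hs)) (hint t (hm₂ _ ht))
    simpa only [← Set.inter_indicator_mul, mul_one] using this
  have h₁ : ∀ g : MeasurableSpace Ω, g ≤ mΩ → μ⟦(Set.univ : Set Ω) | g⟧ = fun _ => (1 : ℝ) :=
    fun g hg => by rw [Set.indicator_univ, condExp_const hg]
  have hs' := key s Set.univ hs MeasurableSet.univ
  have ht' := key Set.univ t MeasurableSet.univ ht
  rw [h₁ g₂ (hg₂.trans hm₂), Set.inter_univ] at hs'
  rw [h₁ g₁ (hg₁.trans hm₁), Set.univ_inter] at ht'
  filter_upwards [key s t hs ht, hs', ht'] with ω e₁ e₂ e₃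
  rw [e₁, Pi.mul_apply, e₂, e₃, mul_one, one_mul]

end ConditionalIndependence

/-! ### From trek separation to conditional independence -/


/-- The σ-algebra on `ℝ^V` generated by the coordinates in `S`. -/
@[reducible]
def coordSigma (S : Set V) : MeasurableSpace (V → ℝ) :=
  ⨆ v ∈ S, MeasurableSpace.comap (fun x : V → ℝ => x v) inferInstance

theorem measurable_coordSigma {S : Set V} {v : V} (hv : v ∈ S) :
    Measurable[coordSigma S] fun x : V → ℝ => x v :=
  measurable_iff_comap_le.2
    (le_iSup₂_of_le (f := fun v (_ : v ∈ S) =>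
      MeasurableSpace.comap (fun x : V → ℝ => x v) inferInstance) v hv le_rfl)

theorem coordSigma_le_iff {S : Set V} {m : MeasurableSpace (V → ℝ)} :
    coordSigma S ≤ m ↔ ∀ v ∈ S, Measurable[m] fun x : V → ℝ => x v := by
  simp only [coordSigma, iSup₂_le_iff, measurable_iff_comap_le]

theorem comap_restrict_eq_coordSigma (C : Finset V) :
    MeasurableSpace.comap (C.restrict : (V → ℝ) → (C → ℝ)) inferInstance =
      coordSigma (C : Set V) := by
  refine le_antisymm ?_ ?_
  · refine measurable_iff_comap_le.1 
      (@measurable_pi_lambda _ _ _ (coordSigma (C : Set V)) _ _ fun c => ?_)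
    exact measurable_coordSigma (Finset.mem_coe.2 c.2)
  · rw [coordSigma_le_iff]
    intro c hc
    exact (measurable_pi_apply (⟨c, hc⟩ : C)).comp
      (comap_measurable (C.restrict : (V → ℝ) → (C → ℝ)))

/-- The error term of the regression of the coordinate `j` on the others with coefficients `L`. -/
def residual [Fintype V] (L : Matrix V V ℝ) (j : V) (x : V → ℝ) : ℝ := x j - ∑ i, L i j * x i

theorem measurable_residual [Fintype V] (L : Matrix V V ℝ) (j : V) : Measurable (residual L j) := by
  unfold residual
  fun_prop

/-- The σ-algebra on `ℝ^V` generated by the error terms with index in `K`. -/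
@[reducible]
def noiseSigma [Fintype V] (L : Matrix V V ℝ) (K : Set V) : MeasurableSpace (V → ℝ) :=
  ⨆ k ∈ K, MeasurableSpace.comap (residual L k) inferInstance

theorem measurable_noiseSigma [Fintype V] (L : Matrix V V ℝ) {K : Set V} {k : V} (hk : k ∈ K) :
    Measurable[noiseSigma L K] (residual L k) :=
  measurable_iff_comap_le.2
    (le_iSup₂_of_le (f := fun k (_ : k ∈ K) =>
      MeasurableSpace.comap (residual L k) inferInstance) k hk le_rfl)

theorem noiseSigma_mono [Fintype V] (L : Matrix V V ℝ) {K K' : Set V} (h : K ⊆ K') :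
    noiseSigma L K ≤ noiseSigma L K' :=
  biSup_mono h

theorem coordSigma_mono {S S' : Set V} (h : S ⊆ S') : coordSigma S ≤ coordSigma S' :=
  biSup_mono h

theorem noiseSigma_le [Fintype V] (L : Matrix V V ℝ) (K : Set V) :
    noiseSigma L K ≤ MeasurableSpace.pi :=
  iSup₂_le fun k _ => (measurable_residual L k).comap_le


/-- The vertices from which a directed path leads to `v` without meeting `D`, where the end points
count as belonging to the path; it is empty if `v ∈ D`. -/
def avoidingAncestors (G : Digraph V) (D : Finset V) (v : V) : Set V :=
  {k | ∃ p, IsDirectedPath G k v p ∧ ∀ c ∈ D, c ∉ p}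

theorem self_mem_avoidingAncestors {G : Digraph V} {D : Finset V} {v : V} (hv : v ∉ D) :
    v ∈ avoidingAncestors G D v :=
  ⟨[v], ⟨rfl, rfl, List.isChain_singleton v⟩, fun _ hc h => hv (List.mem_singleton.1 h ▸ hc)⟩

theorem avoidingAncestors_subset {G : Digraph V} {D : Finset V} {u v : V} (hv : v ∉ D)
    (huv : G.Adj u v) : avoidingAncestors G D u ⊆ avoidingAncestors G D v := by
  rintro k ⟨p, ⟨hk, hu, hp⟩, hD⟩
  refine ⟨p ++ [v], ⟨?_, by simp, ?_⟩, ?_⟩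
  · rw [List.head?_append, hk]
    rfl
  · refine hp.append (List.isChain_singleton v) ?_
    intro x hx y hy
    rw [hu] at hx
    simp only [Option.mem_def, Option.some.injEq, List.head?_cons] at hx hy
    rwa [← hx, ← hy]
  · intro c hc h
    rcases List.mem_append.1 h with h | h
    · exact hD c hc h
    · exact hv (List.mem_singleton.1 h ▸ hc)

/-- Expanding the recursive regressions until a vertex of `D` is met splits the variable at `v` into
a function of the errors that reach `v` along paths avoiding `D` and a function of the variables at
the vertices of `D` from which `v` can be reached. -/
theorem exists_noise_part [Fintype V] {G : Digraph V} (hG : IsAcyclic G) {L : Matrix V V ℝ}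
    (hL : ∀ i j, ¬ G.Adj i j → L i j = 0) (D : Finset V) (v : V) :
    ∃ Y : (V → ℝ) → ℝ, Measurable[noiseSigma L (avoidingAncestors G D v)] Y ∧
      Measurable[coordSigma {c | c ∈ D ∧ Relation.ReflTransGen G.Adj c v}]
        fun x => x v - Y x := by
  induction v using hG.wellFounded.induction with
  | _ v ih =>
    by_cases hv : v ∈ D
    · refine ⟨fun _ => 0, measurable_const, ?_⟩
      simpa only [sub_zero] using measurable_coordSigma
        (show v ∈ {c | c ∈ D ∧ Relation.ReflTransGen G.Adj c v} from ⟨hv, .refl⟩)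
    have hex : ∀ i, ∃ Y : (V → ℝ) → ℝ,
        Measurable[noiseSigma L (avoidingAncestors G D v)] (fun x => L i v * Y x) ∧
        Measurable[coordSigma {c | c ∈ D ∧ Relation.ReflTransGen G.Adj c v}]
          fun x => L i v * (x i - Y x) := by
      intro i
      by_cases hi : G.Adj i v
      · obtain ⟨Y, hY, hY'⟩ := ih i hi
        refine ⟨Y,
          (hY.mono (noiseSigma_mono L (avoidingAncestors_subset hv hi)) le_rfl).const_mul _,
          (hY'.mono (coordSigma_mono ?_) le_rfl).const_mul _⟩
        exact fun c hc => ⟨hc.1, hc.2.tail hi⟩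
      · refine ⟨fun _ => 0, ?_, ?_⟩ <;> simp only [hL i v hi, zero_mul] <;> exact measurable_const
    choose Y hY hY' using hex
    refine ⟨fun x => residual L v x + ∑ i, L i v * Y i x, ?_, ?_⟩
    · exact (measurable_noiseSigma L (self_mem_avoidingAncestors hv)).add
        (Finset.measurable_fun_sum _ fun i _ => hY i)
    · have : (fun x : V → ℝ => x v - (residual L v x + ∑ i, L i v * Y i x)) =
          fun x => ∑ i, L i v * (x i - Y i x) := by
        funext x
        simp only [residual, mul_sub, Finset.sum_sub_distrib]
        ring
      rw [this]
      exact Finset.measurable_fun_sum _ fun i _ => hY' i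

/-- Trek separation implies conditional independence for every family of independent errors,
Gaussian or not. -/
theorem TSeparates.condIndepStatement [Fintype V] [DecidableEq V] {G : Digraph V}
    (hG : IsAcyclic G)
    {A B C CA CB : Finset V} (hC : CA ∪ CB = C) (hdisj : Disjoint CA CB)
    (hsep : TSeparates G CA CB (A ∪ C) (B ∪ C)) {L : Matrix V V ℝ}
    (hL : ∀ i j, ¬ G.Adj i j → L i j = 0) {μ : Measure (V → ℝ)} [IsProbabilityMeasure μ]
    (hμ : iIndepFun (residual L) μ) : CondIndepStatement A B C μ := by
  choose Y hY hYX using exists_noise_part hG hL CA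
  choose Z hZ hZX using exists_noise_part hG hL CB
  set KA : Set V := ⋃ i ∈ A ∪ C, avoidingAncestors G CA i
  set KB : Set V := ⋃ i ∈ B ∪ C, avoidingAncestors G CB i
  have hK : Disjoint KA KB := by
    refine Set.disjoint_left.2 fun k hk hk' => ?_
    obtain ⟨i, hi, p₁, hp₁, h₁⟩ := Set.mem_iUnion₂.1 hk
    obtain ⟨j, hj, p₂, hp₂, h₂⟩ := Set.mem_iUnion₂.1 hk'
    rcases hsep i hi j hj p₁ p₂ ⟨k, hp₁, hp₂⟩ with ⟨c, hc, hcp⟩ | ⟨c, hc, hcp⟩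
    exacts [h₁ c hc hcp, h₂ c hc hcp]
  set m₁ := noiseSigma L KA
  set m₂ := noiseSigma L KB
  have hind : Indep m₁ m₂ μ :=
    indep_iSup_of_disjoint (fun k => (measurable_residual L k).comap_le) hμ.iIndep hK
  have hY₁ : ∀ i ∈ A ∪ C, Measurable[m₁] (Y i) := fun i hi =>
    (hY i).mono (noiseSigma_mono L (Set.subset_biUnion_of_mem
      (u := fun i => avoidingAncestors G CA i) hi)) le_rfl
  have hZ₁ : ∀ i ∈ B ∪ C, Measurable[m₂] (Z i) := fun i hi =>
    (hZ i).mono (noiseSigma_mono L (Set.subset_biUnion_of_mem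
      (u := fun i => avoidingAncestors G CB i) hi)) le_rfl
  have hCA : CA ⊆ C := hC ▸ Finset.subset_union_left
  have hCB : CB ⊆ C := hC ▸ Finset.subset_union_right
  have hYX' : ∀ v, Measurable[coordSigma (C : Set V)] fun x => x v - Y v x := fun v =>
    (hYX v).mono (coordSigma_mono fun c hc => hCA hc.1) le_rfl
  have hZX' : ∀ v, Measurable[coordSigma (C : Set V)] fun x => x v - Z v x := fun v =>
    (hZX v).mono (coordSigma_mono fun c hc => hCB hc.1) le_rfl
  set g₁ : MeasurableSpace (V → ℝ) := ⨆ c ∈ CB, MeasurableSpace.comap (Y c) inferInstance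
  set g₂ : MeasurableSpace (V → ℝ) := ⨆ c ∈ CA, MeasurableSpace.comap (Z c) inferInstance
  have hgm₁ : g₁ ≤ m₁ := iSup₂_le fun c hc =>
    (hY₁ c (Finset.mem_union_right _ (hCB hc))).comap_le
  have hgm₂ : g₂ ≤ m₂ := iSup₂_le fun c hc =>
    (hZ₁ c (Finset.mem_union_right _ (hCA hc))).comap_le
  have hYg : ∀ c ∈ CB, Measurable[g₁ ⊔ g₂] (Y c) := fun c hc =>
    measurable_iff_comap_le.2 (le_sup_of_le_left (le_iSup₂_of_le
      (f := fun c (_ : c ∈ CB) => MeasurableSpace.comap (Y c) inferInstance) c hc le_rfl))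
  have hZg : ∀ c ∈ CA, Measurable[g₁ ⊔ g₂] (Z c) := fun c hc =>
    measurable_iff_comap_le.2 (le_sup_of_le_right (le_iSup₂_of_le
      (f := fun c (_ : c ∈ CA) => MeasurableSpace.comap (Z c) inferInstance) c hc le_rfl))
  -- The conditioning variables and the pair `(Y_CB, Z_CA)` determine each other.
  have hσ : coordSigma (C : Set V) = g₁ ⊔ g₂ := by
    refine le_antisymm (coordSigma_le_iff.2 fun v => ?_)
      (sup_le (iSup₂_le fun c hc => ?_) (iSup₂_le fun c hc => ?_))
    · induction v using hG.wellFounded_transGen.induction with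
      | _ v ih =>
        intro hv
        have hlt : ∀ D D' : Finset V, D ⊆ C → Disjoint D D' → v ∈ D' →
            coordSigma {c | c ∈ D ∧ Relation.ReflTransGen G.Adj c v} ≤ g₁ ⊔ g₂ := by
          intro D D' hD hDD' hv'
          rw [coordSigma_le_iff]
          rintro c ⟨hcD, hcv⟩
          rcases Relation.reflTransGen_iff_eq_or_transGen.1 hcv with rfl | hcv
          · exact absurd hv' (Finset.disjoint_left.1 hDD' hcD)
          · exact ih c hcv (hD hcD)
        rcases Finset.mem_union.1 (hC ▸ hv : v ∈ CA ∪ CB) with hv' | hv'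
        · simpa [Pi.add_def] using
            (hZg v hv').add ((hZX v).mono (hlt CB CA hCB hdisj.symm hv') le_rfl)
        · simpa [Pi.add_def] using
            (hYg v hv').add ((hYX v).mono (hlt CA CB hCA hdisj hv') le_rfl)
    · refine measurable_iff_comap_le.1 ?_
      simpa [Pi.sub_def] using
        (measurable_coordSigma (Finset.mem_coe.2 (hCB hc))).sub (hYX' c)
    · refine measurable_iff_comap_le.1 ?_
      simpa [Pi.sub_def] using
        (measurable_coordSigma (Finset.mem_coe.2 (hCA hc))).sub (hZX' c)
  have hAm : coordSigma (A : Set V) ≤ m₁ ⊔ coordSigma (C : Set V) :=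
    coordSigma_le_iff.2 fun v hv => by
      simpa [Pi.add_def] using
        ((hY₁ v (Finset.mem_union_left _ hv)).mono le_sup_left le_rfl).add
        ((hYX' v).mono le_sup_right le_rfl)
  have hBm : coordSigma (B : Set V) ≤ m₂ ⊔ coordSigma (C : Set V) :=
    coordSigma_le_iff.2 fun v hv => by
      simpa [Pi.add_def] using
        ((hZ₁ v (Finset.mem_union_left _ hv)).mono le_sup_left le_rfl).add
        ((hZX' v).mono le_sup_right le_rfl)
  have hm₁ : m₁ ≤ MeasurableSpace.pi := noiseSigma_le L KA
  have hm₂ : m₂ ≤ MeasurableSpace.pi := noiseSigma_le L KB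
  have key : ∀ (m' : MeasurableSpace (V → ℝ)) (hm' : m' ≤ MeasurableSpace.pi), m' = g₁ ⊔ g₂ →
      CondIndep m' m₁ m₂ hm' μ := by
    rintro _ hm' rfl
    exact condIndep_sup_of_indep hm₁ hm₂ hind hgm₁ hgm₂
  rw [← comap_restrict_eq_coordSigma] at hσ hAm hBm
  rw [← comap_restrict_eq_coordSigma] at hAm hBm
  rw [CondIndepStatement, condIndepFun_iff_condIndep]
  exact condIndep_of_condIndep_of_le_left (condIndep_of_condIndep_of_le_right
    (condIndep_sup_sup hm₁ hm₂ (key _ _ hσ)) hBm) hAm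

/-! ### From conditional independence to trek separation -/

section GaussianModel

open Matrix

variable [Fintype V]

/-- The joint law of independent errors with distributions `N(0, φ v)`. -/
noncomputable def noiseLaw (φ : V → ℝ≥0) : Measure (V → ℝ) :=
  Measure.pi fun v => gaussianReal 0 (φ v)

instance (φ : V → ℝ≥0) : IsProbabilityMeasure (noiseLaw φ) := by
  unfold noiseLaw
  infer_instance

theorem hasLaw_noiseLaw (φ : V → ℝ≥0) (v : V) :
    HasLaw (fun e : V → ℝ => e v) (gaussianReal 0 (φ v)) (noiseLaw φ) :=
  (measurePreserving_eval (fun v => gaussianReal 0 (φ v)) v).hasLaw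

theorem iIndepFun_noiseLaw (φ : V → ℝ≥0) :
    iIndepFun (fun (v : V) (e : V → ℝ) => e v) (noiseLaw φ) :=
  iIndepFun_pi (μ := fun v => gaussianReal 0 (φ v)) (X := fun _ x => x) fun _ => aemeasurable_id

theorem hasGaussianLaw_noiseLaw (φ : V → ℝ≥0) :
    HasGaussianLaw (fun e : V → ℝ => e) (noiseLaw φ) :=
  (iIndepFun_noiseLaw φ).hasGaussianLaw fun v => (hasLaw_noiseLaw φ v).hasGaussianLaw

theorem memLp_noiseLaw (φ : V → ℝ≥0) (v : V) :
    MemLp (fun e : V → ℝ => e v) 2 (noiseLaw φ) :=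
  (hasLaw_noiseLaw φ v).hasGaussianLaw.memLp_two

theorem covariance_noiseLaw (φ : V → ℝ≥0) (α β : V → ℝ) :
    cov[fun e => α ⬝ᵥ e, fun e => β ⬝ᵥ e; noiseLaw φ] = ∑ v, α v * φ v * β v := by
  simp only [dotProduct]
  rw [covariance_fun_sum_fun_sum (fun v => (memLp_noiseLaw φ v).const_mul _)
    (fun v => (memLp_noiseLaw φ v).const_mul _)]
  refine Finset.sum_congr rfl fun u _ => ?_
  rw [Finset.sum_eq_single u]
  · rw [covariance_const_mul_left, covariance_const_mul_right,
      covariance_self (measurable_pi_apply u).aemeasurable, (hasLaw_noiseLaw φ u).variance_eq,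
      variance_id_gaussianReal]
    ring
  · intro v _ hvu
    rw [covariance_const_mul_left, covariance_const_mul_right,
      ((iIndepFun_noiseLaw φ).indepFun (Ne.symm hvu)).covariance_eq_zero (memLp_noiseLaw φ u)
        (memLp_noiseLaw φ v), mul_zero, mul_zero]
  · simp

theorem measurable_vecMul (N : Matrix V V ℝ) : Measurable fun e : V → ℝ => e ᵥ* N := by
  unfold Matrix.vecMul dotProduct
  fun_prop

variable [DecidableEq V]

theorem covMatrix_posDef {L : Matrix V V ℝ} (hL : (1 - L).det ≠ 0) {φ : V → ℝ}
    (hφ : ∀ v, 0 < φ v) : (covMatrix L φ).PosDef := by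
  rw [covMatrix, ← Matrix.conjTranspose_eq_transpose_of_trivial]
  refine (Matrix.PosDef.diagonal hφ).conjTranspose_mul_mul_same ?_
  refine Matrix.mulVec_injective_of_isUnit ?_
  rw [Matrix.isUnit_nonsing_inv_iff, Matrix.isUnit_iff_isUnit_det]
  exact isUnit_iff_ne_zero.2 hL

/-- The coefficient vector of the error of the linear regression of the variable `a` on those in
`C`: it has coefficient `1` at `a` and is uncorrelated with all of `C`. -/
theorem exists_regression {M : Matrix V V ℝ} (hM : M.PosDef) {a : V} {C : Finset V} (ha : a ∉ C) :
    ∃ α : V → ℝ, α a = 1 ∧ (∀ v ∉ insert a C, α v = 0) ∧ ∀ c ∈ C, (α ᵥ* M) c = 0 := by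
  set M' : Matrix C C ℝ := M.submatrix Subtype.val Subtype.val
  have hM' : IsUnit M'.det :=
    (Matrix.isUnit_iff_isUnit_det _).1 (hM.submatrix Subtype.val_injective).isUnit
  set β : C → ℝ := (fun c : C => M a c) ᵥ* M'⁻¹ with hβ
  have hβM : β ᵥ* M' = fun c : C => M a c := by
    rw [hβ, Matrix.vecMul_vecMul, Matrix.nonsing_inv_mul _ hM', Matrix.vecMul_one]
  set γ : V → ℝ := Function.extend Subtype.val β 0 with hγ
  have hγ0 : ∀ v, v ∉ C → γ v = 0 := fun v hv => by
    rw [hγ, Function.extend_apply' _ _ _ (by simpa using hv), Pi.zero_apply]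
  refine ⟨Pi.single a 1 - γ, ?_, ?_, ?_⟩
  · simp [hγ0 a ha]
  · intro v hv
    rw [Finset.mem_insert, not_or] at hv
    simp [hγ0 v hv.2, hv.1]
  · intro c hc
    have h1 : (γ ᵥ* M) c = (β ᵥ* M') ⟨c, hc⟩ := by
      rw [Matrix.vecMul, dotProduct, Matrix.vecMul, dotProduct]
      refine (Fintype.sum_of_injective _ Subtype.val_injective _ _ (fun u hu => ?_)
        fun i => ?_).symm
      · rw [hγ0 u (by simpa using hu), zero_mul]
      · rw [hγ, Subtype.val_injective.extend_apply]
        rfl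
    rw [Matrix.sub_vecMul, Pi.sub_apply, h1, hβM, Matrix.single_one_vecMul]
    exact sub_self _

/-- The distribution of the model with edge weights `L` and error variances `φ`: the law of
`X = ε (1 - L)⁻¹`, the solution of `X = X L + ε`. -/
noncomputable def modelLaw (L : Matrix V V ℝ) (φ : V → ℝ≥0) : Measure (V → ℝ) :=
  (noiseLaw φ).map fun e => e ᵥ* (1 - L)⁻¹

instance (L : Matrix V V ℝ) (φ : V → ℝ≥0) : IsProbabilityMeasure (modelLaw L φ) :=
  Measure.isProbabilityMeasure_map (measurable_vecMul _).aemeasurable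

theorem residual_vecMul {L : Matrix V V ℝ} (hL : (1 - L).det ≠ 0) (e : V → ℝ) (j : V) :
    residual L j (e ᵥ* (1 - L)⁻¹) = e j := by
  have h : e ᵥ* (1 - L)⁻¹ ᵥ* (1 - L) = e := by
    rw [Matrix.vecMul_vecMul, Matrix.nonsing_inv_mul _ (isUnit_iff_ne_zero.2 hL),
      Matrix.vecMul_one]
  have h' := congrFun h j
  rw [Matrix.vecMul_sub, Matrix.vecMul_one, Pi.sub_apply] at h'
  rw [residual, ← h']
  exact congrArg _ (Finset.sum_congr rfl fun i _ => mul_comm _ _)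

theorem inModel_modelLaw {G : Digraph V} {L : Matrix V V ℝ}
    (hL : ∀ i j, ¬ G.Adj i j → L i j = 0) (hdet : (1 - L).det ≠ 0) {φ : V → ℝ≥0}
    (hφ : ∀ j, 0 < φ j) : InModel G (modelLaw L φ) := by
  have hmap : ∀ j, (modelLaw L φ).map (residual L j) = gaussianReal 0 (φ j) := fun j => by
    rw [modelLaw, Measure.map_map (measurable_residual L j) (measurable_vecMul _),
      show residual L j ∘ (fun e => e ᵥ* (1 - L)⁻¹) = fun e => e j from
        funext fun e => residual_vecMul hdet e j]
    exact (hasLaw_noiseLaw φ j).map_eq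
  refine ⟨L, φ, hL, hφ, fun j => ⟨(measurable_residual L j).aemeasurable, hmap j⟩, ?_⟩
  change iIndepFun (residual L) (modelLaw L φ)
  rw [iIndepFun_iff_map_fun_eq_pi_map fun j => (measurable_residual L j).aemeasurable]
  simp only [hmap]
  rw [modelLaw, Measure.map_map (measurable_pi_lambda _ fun j => measurable_residual L j)
      (measurable_vecMul _),
    show (fun x j => residual L j x) ∘ (fun e => e ᵥ* (1 - L)⁻¹) = id from
      funext fun e => funext fun j => residual_vecMul hdet e j, Measure.map_id]
  rfl

theorem covariance_modelLaw (L : Matrix V V ℝ) (φ : V → ℝ≥0) (α : V → ℝ) (v : V) :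
    cov[fun x => α ⬝ᵥ x, fun x => x v; modelLaw L φ] = (α ᵥ* covMatrix L fun v => φ v) v := by
  have hm : ∀ α : V → ℝ, Measurable fun x : V → ℝ => α ⬝ᵥ x := fun α => by
    unfold dotProduct
    fun_prop
  rw [modelLaw, covariance_map (hm α).aestronglyMeasurable
    (measurable_pi_apply v).aestronglyMeasurable (measurable_vecMul _).aemeasurable]
  have h1 : (fun x => α ⬝ᵥ x) ∘ (fun e : V → ℝ => e ᵥ* (1 - L)⁻¹) =
      fun e => ((1 - L)⁻¹ *ᵥ α) ⬝ᵥ e := by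
    funext e
    rw [Function.comp_apply, dotProduct_comm, ← Matrix.dotProduct_mulVec, dotProduct_comm]
  have h2 : (fun x : V → ℝ => x v) ∘ (fun e : V → ℝ => e ᵥ* (1 - L)⁻¹) =
      fun e => (fun k => (1 - L)⁻¹ k v) ⬝ᵥ e := by
    funext e
    rw [Function.comp_apply, dotProduct_comm]
    rfl
  rw [h1, h2, covariance_noiseLaw, covMatrix, ← Matrix.vecMul_vecMul, ← Matrix.vecMul_vecMul,
    Matrix.vecMul_transpose, Matrix.vecMul, dotProduct]
  simp only [Matrix.vecMul_diagonal]

/-- Linear images of the model distribution are Gaussian. -/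
theorem hasGaussianLaw_modelLaw (L : Matrix V V ℝ) (φ : V → ℝ≥0) {F : Type*}
    [NormedAddCommGroup F] [NormedSpace ℝ F] [MeasurableSpace F] [BorelSpace F]
    (T : (V → ℝ) →L[ℝ] F) : HasGaussianLaw (fun x => T x) (modelLaw L φ) := by
  let N : (V → ℝ) →L[ℝ] (V → ℝ) := LinearMap.toContinuousLinearMap (1 - L)⁻¹.vecMulLinear
  have h := (hasGaussianLaw_noiseLaw φ).map_fun (T ∘L N)
  refine ⟨?_⟩
  have h' := h.isGaussian_map
  rwa [modelLaw, Measure.map_map T.continuous.measurable (measurable_vecMul _)]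

/-- Conditional independence of `X_A` and `X_B` given `X_C` makes the covariance block with rows
`{a} ∪ C` and columns `{b} ∪ C` singular. -/
theorem CondIndepStatement.exists_vecMul_covMatrix_eq_zero {L : Matrix V V ℝ}
    (hdet : (1 - L).det ≠ 0) {φ : V → ℝ≥0} (hφ : ∀ v, 0 < φ v) {A B C : Finset V} {a b : V}
    (ha : a ∈ A) (hb : b ∈ B) (haC : a ∉ C) (h : CondIndepStatement A B C (modelLaw L φ)) :
    ∃ α : V → ℝ, α a = 1 ∧ (∀ v ∉ insert a C, α v = 0) ∧
      ∀ v ∈ insert b C, (α ᵥ* covMatrix L fun v => φ v) v = 0 := by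
  obtain ⟨α, hαa, hα, hαC⟩ :=
    exists_regression (covMatrix_posDef hdet (φ := fun v => φ v) fun v => by exact_mod_cast hφ v)
      haC
  refine ⟨α, hαa, hα, fun v hv => ?_⟩
  rcases Finset.mem_insert.1 hv with rfl | hv
  swap
  · exact hαC v hv
  set μ := modelLaw L φ
  let R : (V → ℝ) →L[ℝ] ℝ := ∑ u, α u • ContinuousLinearMap.proj u
  have hR : ∀ x, R x = α ⬝ᵥ x := fun x => by simp [R, dotProduct]
  -- The regression error is uncorrelated with the conditioning variables, hence independent.
  have hRC : IndepFun (fun x => R x) (C.restrict : (V → ℝ) → (C → ℝ)) μ := by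
    have hg : HasGaussianLaw (fun x : V → ℝ => ((fun _ : Unit => R x), fun c : C => x c)) μ :=
      hasGaussianLaw_modelLaw L φ ((ContinuousLinearMap.pi fun _ : Unit => R).prod
        (ContinuousLinearMap.pi fun c : C => ContinuousLinearMap.proj (c : V)))
    have hi := HasGaussianLaw.indepFun_of_covariance_eval (X := fun (_ : Unit) x => R x)
      (Y := fun (c : C) x => x (c : V)) hg fun _ c => by
        simp only [hR]
        rw [covariance_modelLaw]
        exact hαC c c.2
    exact hi.comp (measurable_pi_apply ()) measurable_id
  have hRm : MeasurableSpace.comap (fun x => R x) inferInstance ≤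
      coordSigma (A : Set V) ⊔ coordSigma (C : Set V) := by
    refine measurable_iff_comap_le.1 ?_
    simp only [hR, dotProduct]
    refine Finset.measurable_fun_sum _ fun u _ => ?_
    by_cases hu : u ∈ insert a C
    · refine Measurable.const_mul ?_ _
      rcases Finset.mem_insert.1 hu with rfl | hu
      · exact (measurable_coordSigma (Finset.mem_coe.2 ha)).mono le_sup_left le_rfl
      · exact (measurable_coordSigma (Finset.mem_coe.2 hu)).mono le_sup_right le_rfl
    · simp only [hα u hu, zero_mul]
      exact measurable_const
  rw [CondIndepStatement, condIndepFun_iff_condIndep] at h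
  have h1 := condIndep_of_condIndep_of_le_left
    (condIndep_sup_left (Finset.measurable_restrict A).comap_le
      (Finset.measurable_restrict B).comap_le h)
    (m₃ := MeasurableSpace.comap (fun x => R x) inferInstance)
    (by rwa [comap_restrict_eq_coordSigma, comap_restrict_eq_coordSigma])
  have h2 := indep_of_condIndep R.continuous.measurable.comap_le
    (Finset.measurable_restrict B).comap_le h1 hRC
  have hRb : IndepFun (fun x => R x) (fun x : V → ℝ => x v) μ := by
    refine indep_of_indep_of_le_right h2 ?_
    rw [comap_restrict_eq_coordSigma]
    exact measurable_iff_comap_le.1 (measurable_coordSigma (Finset.mem_coe.2 hb))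
  have hcov := hRb.covariance_eq_zero (hasGaussianLaw_modelLaw L φ R).memLp_two
    (hasGaussianLaw_modelLaw L φ (ContinuousLinearMap.proj v)).memLp_two
  simp only [hR] at hcov
  rwa [covariance_modelLaw] at hcov

theorem CondIndepHolds.not_bayesBall {G : Digraph V} (hG : IsAcyclic G) {A B C : Finset V}
    (hAC : Disjoint A C) (hBC : Disjoint B C) (h : CondIndepHolds G A B C) {a b : V} (ha : a ∈ A)
    (hb : b ∈ B) : ¬ BayesBall G C a false b := by
  intro hball
  have haC := Finset.disjoint_left.1 hAC ha
  obtain ⟨L, φ, hL, hφ, hker⟩ :=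
    hball.exists_nonsingular hG haC (Finset.disjoint_left.1 hBC hb)
  have hdet := hG.det_one_sub_ne_zero hL
  lift φ to V → ℝ≥0 using fun v => (hφ v).le
  have hφ' : ∀ v, 0 < φ v := fun v => by exact_mod_cast hφ v
  obtain ⟨α, hαa, hα, hα0⟩ := (h (modelLaw L φ)
    (inModel_modelLaw hL hdet hφ')).exists_vecMul_covMatrix_eq_zero hdet hφ' ha hb haC
  have := hker α hα hα0
  rw [this] at hαa
  exact zero_ne_one hαa

end GaussianModel

end GaussianDAG

theorem theorem2p11 {V : Type*} [Fintype V] [DecidableEq V] (G : Digraph V)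
    (hG : GaussianDAG.IsAcyclic G) (A B C : Finset V)
    (hAB : Disjoint A B) (hAC : Disjoint A C) (hBC : Disjoint B C) :
    GaussianDAG.CondIndepHolds G A B C ↔
      ∃ CA CB : Finset V, CA ∪ CB = C ∧ Disjoint CA CB ∧
        GaussianDAG.TSeparates G CA CB (A ∪ C) (B ∪ C) := by
  constructor
  · exact fun h => GaussianDAG.exists_tSeparates_of_not_bayesBall
      fun a ha b hb => h.not_bayesBall hG hAC hBC ha hb
  · rintro ⟨CA, CB, hC, hdisj, hsep⟩ μ _ ⟨L, φ, hL, -, -, hμ⟩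
    exact hsep.condIndepStatement hG hC hdisj hL hμ
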